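/- Let $A\in\mathbb R^{n\times n}$, $B\in\mathbb R^{n\times m}$, $F\in\mathbb R^{r\times n}$, $R\in\mathbb R^{(n_0-r)\times n}$ with $r\le n_0$, and suppose that the augmented target matrix $W=\begin{pmatrix}F\\R\end{pmatrix}\in\mathbb R^{n_0\times n}$ has full row rank $n_0$. Suppose that $$\operatorname{rank}\begin{pmatrix}FA\\RA\\F\\R\end{pmatrix}=\operatorname{rank}\begin{pmatrix}F\\R\end{pmatrix} \qquad\text{and}\qquad \operatorname{rank}\begin{pmatrix}sF-FA&FB\\sR-RA&RB\end{pmatrix}=\operatorname{rank}\begin{pmatrix}F\\R\end{pmatrix}\quad\text{for all }s\in\mathbb C .$$ Let $W^-$ be any generalised inverse of $W$, i.e. any matrix with $WW^-W=W$, and let $\bar\Lambda=\{\lambda_1,\dots,\lambda_{n_0}\}$ be any collection of $n_0$ complex numbers (repetitions allowed) that is closed under complex conjugation, counting multiplicities. Then there is a gain $Z\in\mathbb R^{m\times n_0}$, i.e. a feedback law $u=-ZWx$ for the system $\dot x=Ax+Bu$, such that the $n_0$ eigenvalues of $WAW^--WBZ$, counted with algebraic multiplicity, are exactly $\bar\Lambda$.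 Moreover, for every such $Z$, these eigenvalues are also eigenvalues of the closed-loop matrix $A-BZW$, counted with algebraic multiplicity. -/

import Mathlib

/-- `G` is a generalised inverse of `W`: only the condition `W G W = W` is required. -/
def IsGeneralizedInverse {ι κ : Type*} [Fintype ι] [Fintype κ]
    (W : Matrix ι κ ℝ) (G : Matrix κ ι ℝ) : Prop :=
  W * G * W = W

/-- A real matrix regarded as a complex matrix. -/
noncomputable def complexify {ι κ : Type*} (M : Matrix ι κ ℝ) : Matrix ι κ ℂ :=
  M.map (algebraMap ℝ ℂ)

/-- The complex eigenvalues of a real square matrix, each repeated according to its algebraic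
multiplicity. -/
noncomputable def eig {ι : Type*} [Fintype ι] [DecidableEq ι] (M : Matrix ι ι ℝ) : Multiset ℂ :=
  (complexify M).charpoly.roots

/-!
Write `W` for the augmented target matrix. Full row rank turns `W G W = W` into `W G = 1`, and the
first rank condition says that the rows of `W A` lie in the row space of `W`, so that `W A = N W`
with `N = W A G` (`mul_mul_eq_of_rank_fromRows_eq`). Hence `y = W x` obeys a system of its own,
`y' = N y + (W B) u`, and the second rank condition is the Popov–Belevitch–Hautus test for the pair
`(N, W B)`, which makes it reachable over `ℝ` (`reachable_of_left_eigenvector_eq_zero`).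

The gain then comes from the pole placement theorem for reachable pairs over a field
(`exists_feedback_charpoly_eq`). By Heymann's lemma a preliminary feedback makes a single vector
in the range of the input map cyclic (`exists_feedback_linearIndependent`); for a cyclic vector the
controller basis gives a rank one feedback with any prescribed monic characteristic polynomial
(`exists_rank_one_feedback_charpoly_eq`). A conjugation-closed multiset is the root multiset of a
real monic polynomial (`exists_real_monic_map_eq`), which is the polynomial to prescribe.

Finally `W (A - B Z W) = (N - W B Z) W` exhibits `N - W B Z` as a factor of the closed loop by the
surjection `W`, so its characteristic polynomial divides that of `A - B Z W`
(`charpoly_dvd_of_surjective_of_comp_eq`).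
-/

open Module Polynomial

/-! ### Characteristic polynomials of factors -/

/-- The characteristic polynomial of a factor divides that of the whole: in a basis adapted to
`V = ker π ⊕ C`, with `C` identified with `V'` through `π`, the matrix of `f` is block upper
triangular with lower right block the matrix of `g`. -/
theorem charpoly_dvd_of_surjective_of_comp_eq {k V V' : Type*} [Field k]
    [AddCommGroup V] [Module k V] [FiniteDimensional k V]
    [AddCommGroup V'] [Module k V'] [FiniteDimensional k V']
    (π : V →ₗ[k] V') (hπ : Function.Surjective π) (f : End k V) (g : End k V')
    (h : π ∘ₗ f = g ∘ₗ π) : g.charpoly ∣ f.charpoly := by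
  obtain ⟨C, hC⟩ := Submodule.exists_isCompl (LinearMap.ker π)
  let e : (LinearMap.ker π × C) ≃ₗ[k] V := Submodule.prodEquivOfIsCompl _ _ hC
  have hbij : Function.Bijective (π ∘ₗ C.subtype) := by
    constructor
    · rw [← LinearMap.ker_eq_bot, LinearMap.ker_eq_bot']
      intro c hc
      exact Subtype.ext (Submodule.disjoint_def.1 hC.disjoint c.1 (by simpa using hc) c.2)
    · intro y
      obtain ⟨x, rfl⟩ := hπ y
      refine ⟨(e.symm x).2, ?_⟩
      conv_rhs => rw [← e.apply_symm_apply x]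
      have : π (e.symm x).1.1 = 0 := (e.symm x).1.2
      rw [Submodule.coe_prodEquivOfIsCompl', map_add, this, zero_add]
      rfl
  let c : C ≃ₗ[k] V' := LinearEquiv.ofBijective _ hbij
  let b₁ := finBasis k (LinearMap.ker π)
  let b₂ := finBasis k V'
  let b : Basis _ k V := (b₁.prod (b₂.map c.symm)).map e
  have hk : ∀ i, (b (Sum.inl i)) = (b₁ i : V) := fun i => by
    simp [b, e]
  have hrepr : ∀ x j, b.repr x (Sum.inr j) = b₂.repr (π x) j := by
    intro x j
    obtain ⟨y, rfl⟩ := e.surjective x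
    have : π (y.1 : V) = 0 := y.1.2
    simp [b, e, Submodule.coe_prodEquivOfIsCompl', this, c]
  have hpi : ∀ j, π (b (Sum.inr j)) = b₂ j := fun j => by
    have : (π ∘ₗ C.subtype) (c.symm (b₂ j)) = b₂ j := c.apply_symm_apply (b₂ j)
    simpa [b, e] using this
  have hπf : ∀ x, π (f x) = g (π x) := fun x => LinearMap.congr_fun h x
  have h₂₁ : (LinearMap.toMatrix b b f).toBlocks₂₁ = 0 := by
    ext i j
    simp [Matrix.toBlocks₂₁, LinearMap.toMatrix_apply, hrepr, hk, hπf]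
  have h₂₂ : (LinearMap.toMatrix b b f).toBlocks₂₂ = LinearMap.toMatrix b₂ b₂ g := by
    ext i j
    simp [Matrix.toBlocks₂₂, LinearMap.toMatrix_apply, hrepr, hπf, hpi]
  rw [← LinearMap.charpoly_toMatrix f b, ← LinearMap.charpoly_toMatrix g b₂,
    ← Matrix.fromBlocks_toBlocks (LinearMap.toMatrix b b f), h₂₁, h₂₂,
    Matrix.charpoly_fromBlocks_zero₂₁]
  exact dvd_mul_left _ _

/-! ### Pole placement over a field -/

/-- Heymann's lemma: for a reachable pair `(f, B)` some feedback `K` and some input `u` make the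
first `i` iterates of `B u` under `f + B K` independent, for every `i` up to the dimension. The
iterates are prolonged one at a time. If the next one falls into the span `S` of its
predecessors, then `S` is invariant, so by reachability some `B w` lies outside `S`; a rank one
change of `K`, supported on the last iterate, adds `B w` to the next iterate and leaves the
earlier ones unchanged. -/
theorem exists_feedback_linearIndependent {k V U : Type*} [Field k]
    [AddCommGroup V] [Module k V] [AddCommGroup U] [Module k U] [FiniteDimensional k V]
    (f : End k V) (B : U →ₗ[k] V)
    (hreach : ∀ S : Submodule k V, S ≤ S.comap f → LinearMap.range B ≤ S → S = ⊤)
    (i : ℕ) (hi : i ≤ finrank k V) :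
    ∃ (K : V →ₗ[k] U) (u : U),
      LinearIndependent k fun j : Fin i => ((f + B ∘ₗ K) ^ (j : ℕ)) (B u) := by
  induction i with
  | zero => exact ⟨0, 0, linearIndependent_empty_type⟩
  | succ i ih =>
    obtain ⟨K, u, hli⟩ := ih (by omega)
    set g := f + B ∘ₗ K with hg
    set S := Submodule.span k (Set.range fun j : Fin i => (g ^ (j : ℕ)) (B u)) with hS
    have hSlt : S ≠ ⊤ := by
      intro h
      have h1 := finrank_span_eq_card hli
      rw [← hS, h, finrank_top, Fintype.card_fin] at h1
      omega
    have hmem : ∀ j < i, (g ^ j) (B u) ∈ S := fun j hj =>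
      Submodule.subset_span ⟨⟨j, hj⟩, rfl⟩
    by_cases hx : (g ^ i) (B u) ∈ S
    · have hSg : S ≤ S.comap g := by
        rw [hS, Submodule.span_le]
        rintro _ ⟨j, rfl⟩
        change g ((g ^ (j : ℕ)) (B u)) ∈ S
        rw [← Module.End.mul_apply, ← pow_succ']
        rcases Nat.lt_or_ge (j + 1) i with h | h
        · exact hmem _ h
        · have : (j : ℕ) + 1 = i := by omega
          rwa [this]
      have hBS : ¬ LinearMap.range B ≤ S := by
        intro h
        refine hSlt (hreach S (fun v hv => ?_) h)
        have h1 : g v ∈ S := hSg hv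
        have h2 : B (K v) ∈ S := h ⟨_, rfl⟩
        have h3 : f v = g v - B (K v) := by simp [hg]
        rw [Submodule.mem_comap, h3]
        exact S.sub_mem h1 h2
      obtain ⟨_, ⟨w, rfl⟩, hw⟩ := SetLike.not_le_iff_exists.1 hBS
      rcases Nat.eq_zero_or_pos i with rfl | hipos
      · refine ⟨K, w, ?_⟩
        have : B w ≠ 0 := fun h => hw (h ▸ S.zero_mem)
        refine linearIndependent_finSucc'.2 ⟨linearIndependent_empty_type, ?_⟩
        simpa [Set.range_eq_empty] using this
      · obtain ⟨l, rfl⟩ : ∃ l, i = l + 1 := ⟨i - 1, by omega⟩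
        have hlast : (g ^ l) (B u) ∉
            Submodule.span k (Set.range fun j : Fin l => (g ^ (j : ℕ)) (B u)) := by
          have := (linearIndependent_finSucc'.1 hli).2
          exact this
        -- `φ` singles out the last iterate, so that only the image of that iterate changes.
        obtain ⟨φ, hφ, hker⟩ := Submodule.exists_le_ker_of_notMem hlast
        let K' : V →ₗ[k] U := K + φ.smulRight ((φ ((g ^ l) (B u)))⁻¹ • w)
        set g' := f + B ∘ₗ K' with hg'
        have hg'v : ∀ v, g' v = g v + φ v • (φ ((g ^ l) (B u)))⁻¹ • B w := fun v => by
          simp [hg', K', hg, add_assoc]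
        have hpow : ∀ j ≤ l, (g' ^ j) (B u) = (g ^ j) (B u) := by
          intro j
          induction j with
          | zero => simp
          | succ j ihj =>
            intro hj
            have h0 : φ ((g ^ j) (B u)) = 0 := hker (Submodule.subset_span ⟨⟨j, hj⟩, rfl⟩)
            rw [pow_succ', Module.End.mul_apply, ihj (by omega), hg'v, h0, zero_smul, add_zero,
              pow_succ', Module.End.mul_apply]
        refine ⟨K', u, linearIndependent_finSucc'.2 ⟨?_, ?_⟩⟩
        · convert hli using 2 with j
          exact hpow j (by omega)
        · have hlast' : (g' ^ (l + 1)) (B u) = (g ^ (l + 1)) (B u) + B w := by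
            rw [pow_succ', Module.End.mul_apply, hpow l le_rfl, hg'v, smul_smul,
              mul_inv_cancel₀ hφ, one_smul, pow_succ', Module.End.mul_apply]
          have hinit : (Fin.init fun j : Fin (l + 1 + 1) => (g' ^ (j : ℕ)) (B u)) =
              fun j : Fin (l + 1) => (g ^ (j : ℕ)) (B u) := by
            funext j
            exact hpow j (by omega)
          rw [hinit, ← hS]
          simp only [Fin.val_last]
          rw [hlast', S.add_mem_iff_right hx]
          exact hw
    · refine ⟨K, u, linearIndependent_finSucc'.2 ⟨hli, ?_⟩⟩
      exact hx

/-- For a cyclic endomorphism the minimal polynomial has full degree, so any monic polynomial of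
degree `dim V` that annihilates the cyclic vector is the characteristic polynomial. -/
theorem charpoly_eq_of_aeval_eq_zero_of_cyclic {k V : Type*} [Field k]
    [AddCommGroup V] [Module k V] [FiniteDimensional k V]
    (f : End k V) (b : V) (hb : ∀ v, ∃ q : k[X], v = aeval f q b)
    (p : k[X]) (hp : p.Monic) (hdeg : p.natDegree = finrank k V) (h0 : aeval f p b = 0) :
    f.charpoly = p := by
  have hp0 : aeval f p = 0 := by
    ext v
    obtain ⟨q, rfl⟩ := hb v
    rw [← Module.End.mul_apply, ← map_mul, mul_comm, map_mul, Module.End.mul_apply, h0]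
    simp
  have hmin := minpoly.monic (Algebra.IsIntegral.isIntegral (R := k) f)
  have hle : finrank k V ≤ (minpoly k f).natDegree := by
    let T : degreeLT k (minpoly k f).natDegree →ₗ[k] V :=
      (LinearMap.applyₗ b ∘ₗ (aeval f : k[X] →ₐ[k] End k V).toLinearMap) ∘ₗ Submodule.subtype _
    have hT : Function.Surjective T := by
      intro v
      obtain ⟨q, rfl⟩ := hb v
      refine ⟨⟨q %ₘ minpoly k f, mem_degreeLT.2 ?_⟩, ?_⟩
      · exact (degree_modByMonic_lt q hmin).trans_le degree_le_natDegree
      · have : aeval f (q %ₘ minpoly k f) = aeval f q :=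
          aeval_modByMonic_eq_self_of_root (minpoly.aeval k f)
        simp [T, this]
    have h1 := LinearMap.finrank_le_finrank_of_surjective hT
    rwa [(degreeLTEquiv k _).finrank_eq, finrank_fin_fun] at h1
  have h1 : p = minpoly k f :=
    eq_of_monic_of_dvd_of_natDegree_le hmin hp (minpoly.dvd k f hp0) (hdeg ▸ hle)
  rw [h1]
  exact eq_of_monic_of_dvd_of_natDegree_le hmin f.charpoly_monic
    (LinearMap.minpoly_dvd_charpoly f) (f.charpoly_natDegree ▸ hle)

theorem coeff_iterate_divX {k : Type*} [CommSemiring k] (p : k[X]) (i j : ℕ) :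
    (divX^[j] p).coeff i = p.coeff (i + j) := by
  induction j generalizing i with
  | zero => simp
  | succ j ih => rw [Function.iterate_succ_apply', coeff_divX, ih]; congr 1; ring

/-- One step of Horner's scheme; `divX^[j] p` is the part of `p` with coefficients from degree
`j` on. -/
theorem iterate_divX_eq {k : Type*} [CommSemiring k] (p : k[X]) (j : ℕ) :
    divX^[j] p = X * divX^[j + 1] p + C (p.coeff j) := by
  rw [Function.iterate_succ_apply', mul_comm]
  conv_lhs => rw [← divX_mul_X_add (divX^[j] p), coeff_iterate_divX, zero_add]

theorem iterate_divX_natDegree {k : Type*} [CommSemiring k] {p : k[X]} (hp : p.Monic) :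
    divX^[p.natDegree] p = 1 := by
  ext i
  rw [coeff_iterate_divX, coeff_one]
  split_ifs with h
  · simp [h, hp]
  · exact coeff_eq_zero_of_natDegree_lt (by omega)

/-- Pole placement with a single input `b`. Let `a` be the characteristic polynomial of `f`. The
Horner vectors `e j = (divX^[j + 1] a)(f) b`, for `j < dim V`, form the controller basis, in which
`f` acts by `e j ↦ e (j - 1) - a.coeff j • b`, with `0` for `e (-1)`. The feedback that sends `e j` to
`a.coeff j - p.coeff j` therefore turns the coefficients of `a` in this recursion into those
of `p`. -/
theorem exists_rank_one_feedback_charpoly_eq {k V : Type*} [Field k]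
    [AddCommGroup V] [Module k V] [FiniteDimensional k V]
    (f : End k V) (b : V) (hb : ∀ v, ∃ q : k[X], v = aeval f q b)
    (p : k[X]) (hp : p.Monic) (hdeg : p.natDegree = finrank k V) :
    ∃ φ : V →ₗ[k] k, (f + φ.smulRight b).charpoly = p := by
  set n := finrank k V with hn
  set a := f.charpoly with ha
  have hadeg : a.natDegree = n := f.charpoly_natDegree
  have ha0 : aeval f a = 0 := f.aeval_self_charpoly
  let e : ℕ → V := fun j => aeval f (divX^[j + 1] a) b
  have hstep : ∀ j, f (e j) + a.coeff j • b = aeval f (divX^[j] a) b := fun j => by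
    rw [iterate_divX_eq a j]
    simp [e, algebraMap_end_apply]
  have htop : e (n - 1) = b ∨ n = 0 := by
    rcases Nat.eq_zero_or_pos n with h | h
    · exact Or.inr h
    · left
      have h1 := iterate_divX_natDegree f.charpoly_monic
      rw [← ha, hadeg] at h1
      simp only [e, Nat.sub_add_cancel h, h1, map_one, Module.End.one_apply]
  have hnil : aeval f (divX^[0] a) b = 0 := by simp [ha0]
  have hfz : f (e 0) = - (a.coeff 0 • b) := by
    rw [eq_neg_iff_add_eq_zero, hstep, hnil]
  have hfs : ∀ j, f (e (j + 1)) = e j - a.coeff (j + 1) • b := fun j => by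
    rw [eq_sub_iff_add_eq, hstep]
  have hspan : ⊤ ≤ Submodule.span k (Set.range fun j : Fin n => e j) := by
    rcases htop with htop | h0
    swap
    · have : Subsingleton V := finrank_zero_iff.1 (hn ▸ h0)
      exact fun v _ => by rw [Subsingleton.elim v 0]; exact Submodule.zero_mem _
    rcases Nat.eq_zero_or_pos n with h | hpos
    · have : Subsingleton V := finrank_zero_iff.1 (hn ▸ h)
      exact fun v _ => by rw [Subsingleton.elim v 0]; exact Submodule.zero_mem _
    set S := Submodule.span k (Set.range fun j : Fin n => e j) with hS
    have hmem : ∀ j < n, e j ∈ S := fun j hj => Submodule.subset_span ⟨⟨j, hj⟩, rfl⟩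
    have hbS : b ∈ S := htop ▸ hmem _ (by omega)
    have hinv : S ≤ S.comap f := by
      rw [hS, Submodule.span_le]
      rintro _ ⟨⟨j, hj⟩, rfl⟩
      change f (e j) ∈ S
      cases j with
      | zero => rw [hfz]; exact S.neg_mem (S.smul_mem _ hbS)
      | succ j => rw [hfs]; exact S.sub_mem (hmem _ (by omega)) (S.smul_mem _ hbS)
    intro v _
    obtain ⟨q, rfl⟩ := hb v
    induction q using Polynomial.induction_on' with
    | add p q hp hq => simpa using S.add_mem (hp trivial) (hq trivial)
    | monomial i c =>
      have : (f ^ i) b ∈ S := by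
        clear * - hbS hinv
        induction i with
        | zero => simpa
        | succ i ih => rw [pow_succ', Module.End.mul_apply]; exact hinv ih
      rw [← C_mul_X_pow_eq_monomial]
      simpa [algebraMap_end_apply] using S.smul_mem c this
  let E := basisOfTopLeSpanOfCardEqFinrank (fun j : Fin n => e j) hspan (by simp [hn])
  let φ : V →ₗ[k] k := E.constr k fun j : Fin n => a.coeff j - p.coeff j
  have hφ : ∀ j < n, φ (e j) = a.coeff j - p.coeff j := fun j hj => by
    have h1 : E ⟨j, hj⟩ = e j := by simp [E]
    rw [← h1, Basis.constr_basis]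
  refine ⟨φ, ?_⟩
  set g := f + φ.smulRight b with hg
  have hgstep : ∀ j < n, g (e j) + p.coeff j • b = f (e j) + a.coeff j • b := fun j hj => by
    simp only [hg, LinearMap.add_apply, LinearMap.smulRight_apply, hφ j hj, sub_smul]
    abel
  have hpn := iterate_divX_natDegree hp
  rw [hdeg] at hpn
  -- The same vectors are the Horner vectors of `p` for the closed loop `g`; the induction runs
  -- down from the top index, where both are `b`.
  have hepoly : ∀ i j, i + j + 1 = n → e j = aeval g (divX^[j + 1] p) b := by
    intro i
    induction i with
    | zero =>
      intro j hj
      rcases htop with h | h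
      · have : n - 1 = j := by omega
        rw [show j + 1 = n by omega, hpn, ← this, h]; simp
      · omega
    | succ i ih =>
      intro j hj
      have h1 := hgstep (j + 1) (by omega)
      rw [hfs, sub_add_cancel] at h1
      rw [iterate_divX_eq p (j + 1), ← h1, ih (j + 1) (by omega)]
      simp [algebraMap_end_apply]
  have hp0 : aeval g p b = 0 := by
    rcases Nat.eq_zero_or_pos n with h | hpos
    · have : Subsingleton V := finrank_zero_iff.1 (hn ▸ h)
      exact Subsingleton.elim _ _
    · have h1 := hgstep 0 hpos
      rw [hfz, neg_add_cancel, hepoly (n - 1) 0 (by omega)] at h1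
      have h2 := iterate_divX_eq p 0
      simp only [Function.iterate_zero, id_eq] at h2
      rw [h2, ← h1, map_add, map_mul]
      simp only [aeval_X, aeval_C, LinearMap.add_apply, Module.End.mul_apply, algebraMap_end_apply]
  refine charpoly_eq_of_aeval_eq_zero_of_cyclic g b (fun v => ?_) p hp hdeg hp0
  have hv : v ∈ Submodule.span k (Set.range fun j : Fin n => e j) := hspan trivial
  induction hv using Submodule.span_induction with
  | mem x hx =>
    obtain ⟨⟨j, hj⟩, rfl⟩ := hx
    exact ⟨_, hepoly (n - 1 - j) j (by omega)⟩
  | zero => exact ⟨0, by simp⟩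
  | add x y _ _ hx hy =>
    obtain ⟨q, rfl⟩ := hx
    obtain ⟨r, rfl⟩ := hy
    exact ⟨q + r, by simp⟩
  | smul c x _ hx =>
    obtain ⟨q, rfl⟩ := hx
    exact ⟨C c * q, by simp [algebraMap_end_apply]⟩

/-- Pole placement for a reachable pair over an arbitrary field. Reachability is expressed by
saying that no proper invariant subspace contains the range of `B`. -/
theorem exists_feedback_charpoly_eq {k V U : Type*} [Field k]
    [AddCommGroup V] [Module k V] [AddCommGroup U] [Module k U] [FiniteDimensional k V]
    (f : End k V) (B : U →ₗ[k] V)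
    (hreach : ∀ S : Submodule k V, S ≤ S.comap f → LinearMap.range B ≤ S → S = ⊤)
    (p : k[X]) (hp : p.Monic) (hdeg : p.natDegree = finrank k V) :
    ∃ K : V →ₗ[k] U, (f + B ∘ₗ K).charpoly = p := by
  obtain ⟨K, u, hli⟩ := exists_feedback_linearIndependent f B hreach _ le_rfl
  obtain ⟨φ, hφ⟩ := exists_rank_one_feedback_charpoly_eq (f + B ∘ₗ K) (B u) (fun v => by
    have hv : v ∈ Submodule.span k (Set.range fun j : Fin (finrank k V) =>
        ((f + B ∘ₗ K) ^ (j : ℕ)) (B u)) := by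
      rw [hli.span_eq_top_of_card_eq_finrank' (by simp)]; trivial
    obtain ⟨c, rfl⟩ := (Submodule.mem_span_range_iff_exists_fun k).1 hv
    exact ⟨∑ j, C (c j) * X ^ (j : ℕ), by simp [algebraMap_end_apply]⟩) p hp hdeg
  refine ⟨K + φ.smulRight u, ?_⟩
  rw [← hφ]
  congr 1
  ext v
  simp [add_assoc]

/-! ### Real pairs and complex spectra -/

theorem complexify_mul {ι κ μ : Type*} [Fintype κ] (M : Matrix ι κ ℝ) (N : Matrix κ μ ℝ) :
    complexify (M * N) = complexify M * complexify N :=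
  Matrix.map_mul

theorem complexify_mulVec {ι κ : Type*} [Fintype κ] (M : Matrix ι κ ℝ) (x : κ → ℝ) :
    (complexify M).mulVec (fun j => (x j : ℂ)) = fun i => (M.mulVec x i : ℂ) := by
  ext i
  simp [complexify, Matrix.mulVec, dotProduct]

theorem eig_eq_roots_map {ι : Type*} [Fintype ι] [DecidableEq ι] (M : Matrix ι ι ℝ) :
    eig M = (M.charpoly.map (algebraMap ℝ ℂ)).roots := by
  rw [eig, complexify, ← Matrix.charpoly_map]

theorem vecMul_injective_of_rank_eq_card {k ι κ : Type*} [Field k] [Fintype ι] [Fintype κ]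
    (M : Matrix ι κ k) (h : M.rank = Fintype.card ι) : Function.Injective M.vecMul := by
  rw [Matrix.vecMul_injective_iff, linearIndependent_iff_card_eq_finrank_span, Set.finrank,
    ← Matrix.rank_eq_finrank_span_row, h]

/-- The Popov–Belevitch–Hautus test: if no complex left eigenvector of `N` annihilates `M`, then
the real pair `(N, M)` is reachable. A real functional vanishing on a proper invariant subspace
`S ⊇ range M` shows that the complex annihilator of `S` is nonzero; it is invariant under
`w ↦ w N`, hence contains an eigenvector, which annihilates `M`. -/
theorem reachable_of_left_eigenvector_eq_zero {ι κ : Type*} [Fintype ι] [DecidableEq ι]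
    [Fintype κ] [DecidableEq κ] (N : Matrix ι ι ℝ) (M : Matrix ι κ ℝ)
    (h : ∀ (s : ℂ) (w : ι → ℂ), Matrix.vecMul w (complexify N) = s • w →
      Matrix.vecMul w (complexify M) = 0 → w = 0)
    (S : Submodule ℝ (ι → ℝ)) (hN : S ≤ S.comap N.mulVecLin)
    (hM : LinearMap.range M.mulVecLin ≤ S) : S = ⊤ := by
  by_contra hS
  obtain ⟨φ, hφ0, hφ⟩ := Submodule.exists_le_ker_of_lt_top S (lt_top_iff_ne_top.2 hS)
  let T : Submodule ℂ (ι → ℂ) :=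
    { carrier := {w | ∀ x ∈ S, w ⬝ᵥ (fun i => (x i : ℂ)) = 0}
      add_mem' := fun ha hb x hx => by rw [add_dotProduct, ha x hx, hb x hx, add_zero]
      zero_mem' := fun x _ => zero_dotProduct _
      smul_mem' := fun a w hw x hx => by rw [smul_dotProduct, hw x hx, smul_zero] }
  have hT : ∀ w ∈ T, (complexify N).vecMulLinear w ∈ T := by
    intro w hw x hx
    rw [Matrix.vecMulLinear_apply, ← Matrix.dotProduct_mulVec, complexify_mulVec]
    exact hw _ (hN hx)
  have hTne : Nontrivial T := by
    let v : ι → ℂ := fun i => (φ (Pi.single i 1) : ℂ)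
    have hv : v ∈ T := by
      intro x hx
      have h1 : φ x = 0 := hφ hx
      rw [LinearMap.pi_apply_eq_sum_univ φ x] at h1
      have h2 := congrArg (fun t : ℝ => (t : ℂ)) h1
      simp only [smul_eq_mul, Complex.ofReal_sum, Complex.ofReal_mul, Complex.ofReal_zero] at h2
      rw [← h2, dotProduct]
      refine Finset.sum_congr rfl fun i _ => ?_
      rw [mul_comm]
      simp only [v]
      congr 4
      ext j
      simp [Pi.single_apply, eq_comm]
    refine nontrivial_of_ne ⟨v, hv⟩ 0 fun h0 => hφ0 ?_
    have h0 : v = 0 := congrArg Subtype.val h0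
    refine LinearMap.pi_ext' fun i => LinearMap.ext_ring ?_
    have := congrFun h0 i
    simpa [v] using this
  obtain ⟨s, hs⟩ := Module.End.exists_eigenvalue (LinearMap.restrict _ hT)
  obtain ⟨w, hw⟩ := hs.exists_hasEigenvector
  have hw1 := congrArg Subtype.val hw.apply_eq_smul
  refine hw.2 (Subtype.ext (h s w.1 hw1 ?_))
  ext j
  have := w.2 _ (hM ⟨Pi.single j 1, rfl⟩)
  rw [Matrix.mulVecLin_apply, ← complexify_mulVec, Matrix.dotProduct_mulVec] at this
  have h1 : (fun i => ((Pi.single j 1 : κ → ℝ) i : ℂ)) = Pi.single j 1 := by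
    ext i
    by_cases h : i = j
    · subst h; simp
    · simp [h]
  rw [h1] at this
  simpa using this

theorem exists_real_monic_map_eq (L : Multiset ℂ) (hconj : L.map (starRingEnd ℂ) = L) :
    ∃ p : ℝ[X], p.Monic ∧ p.natDegree = L.card ∧
      p.map (algebraMap ℝ ℂ) = (L.map fun a => X - C a).prod := by
  set P := (L.map fun a => X - C a).prod with hP
  have hmonic : P.Monic := monic_multiset_prod_of_monic _ _ fun a _ => monic_X_sub_C a
  have hPconj : P.map (starRingEnd ℂ) = P := by
    rw [hP, Polynomial.map_multiset_prod, Multiset.map_map]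
    conv_rhs => rw [← hconj, Multiset.map_map]
    simp
  have hlift : P ∈ lifts (algebraMap ℝ ℂ) := by
    rw [lifts_iff_coeff_lifts]
    intro i
    have h1 : starRingEnd ℂ (P.coeff i) = P.coeff i := by
      conv_rhs => rw [← hPconj, coeff_map]
    obtain ⟨t, ht⟩ := Complex.conj_eq_iff_real.1 h1
    exact ⟨t, ht.symm⟩
  obtain ⟨p, hp, hdeg, hpm⟩ := lifts_and_natDegree_eq_and_monic hlift hmonic
  exact ⟨p, hpm, by rw [hdeg, hP, natDegree_multiset_prod_X_sub_C_eq_card], hp⟩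

theorem exists_gain_eig_eq {ι κ : Type*} [Fintype ι] [DecidableEq ι]
    [Fintype κ] [DecidableEq κ] (N : Matrix ι ι ℝ) (M : Matrix ι κ ℝ)
    (h : ∀ (s : ℂ) (w : ι → ℂ), Matrix.vecMul w (complexify N) = s • w →
      Matrix.vecMul w (complexify M) = 0 → w = 0)
    (L : Multiset ℂ) (hcard : L.card = Fintype.card ι) (hconj : L.map (starRingEnd ℂ) = L) :
    ∃ Z : Matrix κ ι ℝ, eig (N - M * Z) = L := by
  obtain ⟨p, hp, hdeg, hmap⟩ := exists_real_monic_map_eq L hconj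
  obtain ⟨K, hK⟩ := exists_feedback_charpoly_eq N.mulVecLin M.mulVecLin
    (reachable_of_left_eigenvector_eq_zero N M h) p hp
    (by rw [hdeg, hcard, finrank_fintype_fun_eq_card])
  refine ⟨-LinearMap.toMatrix' K, ?_⟩
  have h1 : (N - M * -LinearMap.toMatrix' K).mulVecLin = N.mulVecLin + M.mulVecLin ∘ₗ K := by
    rw [Matrix.mul_neg, sub_neg_eq_add, Matrix.mulVecLin_add, Matrix.mulVecLin_mul,
      ← Matrix.toLin'_apply' (LinearMap.toMatrix' K), Matrix.toLin'_toMatrix']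
  rw [eig_eq_roots_map, ← Matrix.charpoly_mulVecLin, h1, hK, hmap, roots_multiset_prod_X_sub_C]

/-- If `W` is right invertible and intertwines `P` with `Q`, then `Q` is a factor of `P` and its
eigenvalues, with multiplicity, are among those of `P`. -/
theorem eig_le_of_intertwining {ι κ : Type*} [Fintype ι] [DecidableEq ι]
    [Fintype κ] [DecidableEq κ] (W : Matrix ι κ ℝ) (G : Matrix κ ι ℝ) (hWG : W * G = 1)
    (P : Matrix κ κ ℝ) (Q : Matrix ι ι ℝ) (h : W * P = Q * W) : eig Q ≤ eig P := by
  have hsurj : Function.Surjective W.mulVecLin := fun y =>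
    ⟨G.mulVec y, by rw [Matrix.mulVecLin_apply, Matrix.mulVec_mulVec, hWG, Matrix.one_mulVec]⟩
  have hdvd := charpoly_dvd_of_surjective_of_comp_eq W.mulVecLin hsurj P.mulVecLin Q.mulVecLin
    (by rw [← Matrix.mulVecLin_mul, ← Matrix.mulVecLin_mul, h])
  rw [Matrix.charpoly_mulVecLin, Matrix.charpoly_mulVecLin] at hdvd
  rw [eig_eq_roots_map, eig_eq_roots_map]
  exact roots.le_of_dvd ((P.charpoly_monic.map _).ne_zero) (Polynomial.map_dvd _ hdvd)

/-! ### Target output control -/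

/-- If stacking `X` on `W` does not raise the rank, the rows of `X` lie in the row space of `W`,
which is fixed pointwise by `y ↦ y G W` for any generalised inverse `G` of `W`. -/
theorem mul_mul_eq_of_rank_fromRows_eq {k ι κ μ : Type*} [Field k] [Fintype ι] [Fintype κ]
    [Fintype μ] [DecidableEq κ] (X : Matrix μ κ k) (W : Matrix ι κ k) (G : Matrix κ ι k)
    (hG : W * G * W = W) (hrank : (Matrix.fromRows X W).rank = W.rank) : X * G * W = X := by
  have hspan : Submodule.span k (Set.range W.row) =
      Submodule.span k (Set.range (Matrix.fromRows X W).row) := by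
    refine Submodule.eq_of_le_of_finrank_eq (Submodule.span_mono ?_) ?_
    · rintro _ ⟨i, rfl⟩
      exact ⟨Sum.inr i, rfl⟩
    · rw [← Matrix.rank_eq_finrank_span_row, ← Matrix.rank_eq_finrank_span_row, hrank]
  have hker : Submodule.span k (Set.range W.row) ≤
      LinearMap.eqLocus (G * W).vecMulLinear LinearMap.id := by
    rw [Submodule.span_le]
    rintro _ ⟨i, rfl⟩
    have := congrFun hG i
    rw [Matrix.mul_assoc, Matrix.mul_apply_eq_vecMul] at this
    exact this
  funext i
  rw [Matrix.mul_assoc, Matrix.mul_apply_eq_vecMul]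
  exact hker (hspan ▸ Submodule.subset_span ⟨Sum.inl i, rfl⟩)

theorem corollary5 {n m r q : ℕ}
    (A : Matrix (Fin n) (Fin n) ℝ) (B : Matrix (Fin n) (Fin m) ℝ)
    (F : Matrix (Fin r) (Fin n) ℝ) (R : Matrix (Fin q) (Fin n) ℝ)
    -- the augmented target matrix has full row rank `n₀ = r + q`
    (hfull : (Matrix.fromRows F R).rank = r + q)
    -- first rank condition
    (hrank₁ : (Matrix.fromRows (Matrix.fromRows (F * A) (R * A)) (Matrix.fromRows F R)).rank
      = (Matrix.fromRows F R).rank)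
    -- second rank condition
    (hrank₂ : ∀ s : ℂ,
      (Matrix.fromBlocks
          (s • complexify F - complexify (F * A)) (complexify (F * B))
          (s • complexify R - complexify (R * A)) (complexify (R * B))).rank
        = (Matrix.fromRows F R).rank)
    -- an arbitrary generalised inverse of the augmented target matrix
    (G : Matrix (Fin n) (Fin r ⊕ Fin q) ℝ)
    (hG : IsGeneralizedInverse (Matrix.fromRows F R) G)
    -- `n₀` prescribed complex numbers, repetitions allowed, closed under conjugation
    (L : Multiset ℂ) (hcard : L.card = r + q)
    (hconj : L.map (starRingEnd ℂ) = L) :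
    (∃ Z : Matrix (Fin m) (Fin r ⊕ Fin q) ℝ,
        eig (Matrix.fromRows F R * A * G - Matrix.fromRows F R * B * Z) = L) ∧
    (∀ Z : Matrix (Fin m) (Fin r ⊕ Fin q) ℝ,
        eig (Matrix.fromRows F R * A * G - Matrix.fromRows F R * B * Z) = L →
        eig (Matrix.fromRows F R * A * G - Matrix.fromRows F R * B * Z)
          ≤ eig (A - B * Z * Matrix.fromRows F R)) := by
  have hblocks : ∀ s : ℂ, Matrix.fromBlocks
      (s • complexify F - complexify (F * A)) (complexify (F * B))
      (s • complexify R - complexify (R * A)) (complexify (R * B)) =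
      Matrix.fromCols (s • complexify (Matrix.fromRows F R) - complexify (Matrix.fromRows F R * A))
        (complexify (Matrix.fromRows F R * B)) := by
    intro s
    ext (i | i) (j | j) <;> simp [complexify, Matrix.fromRows_mul]
  rw [← Matrix.fromRows_mul] at hrank₁
  simp only [hblocks, hfull] at hrank₂
  set W := Matrix.fromRows F R with hW
  clear_value W
  -- `W * A * G` is the system matrix of the dynamics induced on `y = W x`.
  have hAW : W * A * G * W = W * A := mul_mul_eq_of_rank_fromRows_eq _ _ _ hG hrank₁
  have hWG : W * G = 1 := by
    funext i
    refine vecMul_injective_of_rank_eq_card W (by simpa using hfull) ?_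
    have hi : ∀ P : Matrix (Fin r ⊕ Fin q) (Fin r ⊕ Fin q) ℝ,
        Matrix.vecMul (P i) W = (P * W) i := fun P => (Matrix.mul_apply_eq_vecMul P W i).symm
    change Matrix.vecMul _ W = Matrix.vecMul _ W
    rw [hi, hi, Matrix.one_mul, hG]
  constructor
  · -- A left eigenvector `w` of `W A G` killing `W B` satisfies `w (s W - W A) = 0`, so the rows
    -- of the matrix in the second rank condition would be dependent.
    refine exists_gain_eig_eq _ _ (fun s w hwN hwM => ?_) L (by simpa using hcard) hconj
    refine vecMul_injective_of_rank_eq_card _ (by simpa using hrank₂ s) ?_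
    change Matrix.vecMul _ _ = Matrix.vecMul _ _
    have hNW : Matrix.vecMul w (complexify (W * A)) = s • Matrix.vecMul w (complexify W) := by
      rw [← hAW, complexify_mul, ← Matrix.vecMul_vecMul, hwN, Matrix.smul_vecMul]
    rw [Matrix.zero_vecMul, Matrix.vecMul_fromCols, hwM, Matrix.vecMul_sub, Matrix.vecMul_smul,
      hNW, sub_self]
    ext (j | j) <;> rfl
  · intro Z _
    refine eig_le_of_intertwining W G hWG _ _ ?_
    rw [Matrix.mul_sub, Matrix.sub_mul, hAW]
    simp only [Matrix.mul_assoc]
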